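/- Let $N\ge 1$, let $\mathbb{R}^N_+=\{x\in\mathbb{R}^N: x_1>0\}$, and let $\Omega\subset\mathbb{R}^N$ be an open set with $\overline{\Omega}\subset\mathbb{R}^N_+$. Let $a\in[0,N/2)$, $b\ge 0$, and let $C,K$ be positive constants with $$K\le \frac{N^2}{4}-a^2 \qquad\text{and}\qquad N<2a+2b+2 .$$ Let $u\in W^{2,N}_{loc}(\Omega)\cap C(\overline{\Omega})$ be a real-valued function such that $$u(x)\le C|x|^{-b}\ \text{ in } \Omega,\qquad -\Delta u\le K\,\frac{u}{|x|^2}\ \text{ a.e. in } \Omega,\qquad u\le 0\ \text{ on } \partial\Omega,$$ where $\Delta u$ is formed from the weak second derivatives of $u$. Then $u\le 0$ in $\Omega$. -/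

import Mathlib

open MeasureTheory Set
open scoped ENNReal ContDiff

/-- `g` is the weak partial derivative `∂f/∂xᵢ` on the open set `Ω ⊆ ℝᴺ`: both functions are
locally integrable on `Ω`, and `∫_Ω f ∂φ/∂xᵢ = -∫_Ω g φ` for all test functions `φ ∈ C_c^∞(Ω)`. -/
def HasWeakPartial {N : ℕ} (Ω : Set (EuclideanSpace ℝ (Fin N))) (i : Fin N)
    (f g : EuclideanSpace ℝ (Fin N) → ℝ) : Prop :=
  LocallyIntegrableOn f Ω ∧ LocallyIntegrableOn g Ω ∧
    ∀ φ : EuclideanSpace ℝ (Fin N) → ℝ,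
      ContDiff ℝ ∞ φ → HasCompactSupport φ → tsupport φ ⊆ Ω →
        ∫ x in Ω, f x * fderiv ℝ φ x (EuclideanSpace.single i 1) = -∫ x in Ω, g x * φ x

/-- `f ∈ L^p_loc(Ω)`: `f` is `L^p` on every compact subset of `Ω`. -/
def MemLpLoc {N : ℕ} (p : ℝ≥0∞) (Ω : Set (EuclideanSpace ℝ (Fin N)))
    (f : EuclideanSpace ℝ (Fin N) → ℝ) : Prop :=
  ∀ S : Set (EuclideanSpace ℝ (Fin N)), IsCompact S → S ⊆ Ω → MemLp f p (volume.restrict S)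

/-- `f ∈ W^{k,p}_loc(Ω)`: all weak partial derivatives of `f` up to order `k` exist on `Ω` and
belong to `L^p_loc(Ω)`. -/
def MemSobolevLoc {N : ℕ} (p : ℝ≥0∞) (Ω : Set (EuclideanSpace ℝ (Fin N))) :
    ℕ → (EuclideanSpace ℝ (Fin N) → ℝ) → Prop
  | 0, f => MemLpLoc p Ω f
  | k + 1, f => MemLpLoc p Ω f ∧ ∀ i : Fin N, ∃ g, HasWeakPartial Ω i f g ∧ MemSobolevLoc p Ω k g

/-- `L` is (a version of) the weak Laplacian `Δf = ∑ᵢ ∂²f/∂xᵢ²` on `Ω`, formed from weak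
derivatives. It is unique up to null sets, and exists when `f ∈ W^{2,p}_loc(Ω)`, `p ≥ 1`. -/
def HasWeakLaplacian {N : ℕ} (Ω : Set (EuclideanSpace ℝ (Fin N)))
    (f L : EuclideanSpace ℝ (Fin N) → ℝ) : Prop :=
  ∃ G H : Fin N → EuclideanSpace ℝ (Fin N) → ℝ,
    (∀ i, HasWeakPartial Ω i f (G i)) ∧ (∀ i, HasWeakPartial Ω i (G i) (H i)) ∧
      ∀ᵐ x ∂volume.restrict Ω, L x = ∑ i, H i x

/-- The partial derivative of a function on `ℝᴺ` in the `i`-th coordinate direction. -/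
noncomputable def partialDeriv {N : ℕ} (i : Fin N) (φ : EuclideanSpace ℝ (Fin N) → ℝ) :
    EuclideanSpace ℝ (Fin N) → ℝ :=
  fun x => fderiv ℝ φ x (EuclideanSpace.single i 1)

theorem ContDiff.partialDeriv {N : ℕ} {φ : EuclideanSpace ℝ (Fin N) → ℝ} (h : ContDiff ℝ ∞ φ)
    (i : Fin N) : ContDiff ℝ ∞ (partialDeriv i φ) :=
  (h.fderiv_right (m := ∞) le_rfl).clm_apply contDiff_const

theorem HasCompactSupport.partialDeriv {N : ℕ} {φ : EuclideanSpace ℝ (Fin N) → ℝ}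
    (h : HasCompactSupport φ) (i : Fin N) : HasCompactSupport (partialDeriv i φ) :=
  h.fderiv_apply ℝ _

theorem tsupport_partialDeriv_subset {N : ℕ} (φ : EuclideanSpace ℝ (Fin N) → ℝ) (i : Fin N) :
    tsupport (partialDeriv i φ) ⊆ tsupport φ :=
  tsupport_fderiv_apply_subset ℝ _

theorem MeasureTheory.LocallyIntegrableOn.integrable_mul_of_tsupport_subset {N : ℕ}
    {Ω : Set (EuclideanSpace ℝ (Fin N))}
    {f φ : EuclideanSpace ℝ (Fin N) → ℝ} (hf : LocallyIntegrableOn f Ω) (hφ : Continuous φ)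
    (hc : HasCompactSupport φ) (hs : tsupport φ ⊆ Ω) :
    Integrable (fun x => f x * φ x) (volume.restrict Ω) := by
  have h1 : IntegrableOn (fun x => f x * φ x) (tsupport φ) :=
    (hf.integrableOn_compact_subset hs hc).mul_continuousOn hφ.continuousOn hc
  refine Integrable.integrableOn ?_
  refine (integrableOn_iff_integrable_of_support_subset ?_).1 h1
  exact (Function.support_mul_subset_right _ _).trans (subset_tsupport _)

theorem HasWeakLaplacian.integral_mul {N : ℕ} {Ω : Set (EuclideanSpace ℝ (Fin N))}
    {u Lu : EuclideanSpace ℝ (Fin N) → ℝ} (h : HasWeakLaplacian Ω u Lu) {φ : EuclideanSpace ℝ (Fin N) → ℝ}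
    (hφ : ContDiff ℝ ∞ φ) (hc : HasCompactSupport φ) (hs : tsupport φ ⊆ Ω) :
    Integrable (fun x => Lu x * φ x) (volume.restrict Ω) ∧
    ∫ x in Ω, u x * ∑ i, partialDeriv i (partialDeriv i φ) x = ∫ x in Ω, Lu x * φ x := by
  obtain ⟨G, H, hG, hH, hL⟩ := h
  have hsum : (fun x => Lu x * φ x) =ᵐ[volume.restrict Ω] fun x => ∑ i, H i x * φ x := by
    filter_upwards [hL] with x hx
    rw [hx, Finset.sum_mul]
  have hint : ∀ i, Integrable (fun x => H i x * φ x) (volume.restrict Ω) := fun i =>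
    (hH i).2.1.integrable_mul_of_tsupport_subset hφ.continuous hc hs
  refine ⟨(integrable_finsetSum _ fun i _ => hint i).congr hsum.symm, ?_⟩
  rw [integral_congr_ae hsum, integral_finsetSum _ fun i _ => hint i]
  simp_rw [Finset.mul_sum]
  rw [integral_finsetSum]
  · refine Finset.sum_congr rfl fun i _ => ?_
    have h1 := (hG i).2.2 (partialDeriv i φ) (hφ.partialDeriv i) (hc.partialDeriv i)
      ((tsupport_partialDeriv_subset φ i).trans hs)
    have h2 := (hH i).2.2 φ hφ hc hs
    change ∫ x in Ω, u x * fderiv ℝ (partialDeriv i φ) x _ = _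
    rw [h1]
    change -∫ x in Ω, G i x * fderiv ℝ φ x _ = _
    rw [h2, neg_neg]
  · intro i _
    exact (hG i).1.integrable_mul_of_tsupport_subset ((hφ.partialDeriv i).partialDeriv i).continuous
      ((hc.partialDeriv i).partialDeriv i)
      ((tsupport_partialDeriv_subset _ i).trans ((tsupport_partialDeriv_subset _ i).trans hs))

/-- A pointwise a.e. inequality `-Δu ≤ c` for the weak Laplacian, tested against `φ ≥ 0`. -/
theorem HasWeakLaplacian.neg_integral_le {N : ℕ} {Ω : Set (EuclideanSpace ℝ (Fin N))} (hΩ : IsOpen Ω)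
    {u Lu c : EuclideanSpace ℝ (Fin N) → ℝ} (h : HasWeakLaplacian Ω u Lu) (hcont : ContinuousOn c Ω)
    (hineq : ∀ᵐ x ∂volume.restrict Ω, -Lu x ≤ c x) {φ : EuclideanSpace ℝ (Fin N) → ℝ}
    (hφ : ContDiff ℝ ∞ φ) (hc : HasCompactSupport φ) (hs : tsupport φ ⊆ Ω) (h0 : ∀ x, 0 ≤ φ x) :
    -∫ x in Ω, c x * φ x ≤ ∫ x in Ω, u x * ∑ i, partialDeriv i (partialDeriv i φ) x := by
  obtain ⟨hi, he⟩ := h.integral_mul hφ hc hs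
  rw [he, ← integral_neg]
  refine integral_mono_ae ?_ hi ?_
  · exact ((hcont.locallyIntegrableOn hΩ.measurableSet).integrable_mul_of_tsupport_subset
      hφ.continuous hc hs).neg
  · filter_upwards [hineq] with x hx
    nlinarith [h0 x]

theorem hasLineDerivAt_norm_rpow {N : ℕ} (q : ℝ) (i : Fin N) {x : EuclideanSpace ℝ (Fin N)}
    (hx : x ≠ 0) :
    HasLineDerivAt ℝ (fun z : EuclideanSpace ℝ (Fin N) => ‖z‖ ^ q) (q * ‖x‖ ^ (q - 2) * x i) x
      (EuclideanSpace.single i 1) := by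
  have hn : 0 < ‖x‖ := norm_pos_iff.2 hx
  have h1 : HasDerivAt (fun t : ℝ => ‖x + t • EuclideanSpace.single i (1 : ℝ)‖ ^ 2) (2 * x i) 0 := by
    have := (hasStrictFDerivAt_norm_sq x).hasFDerivAt.hasLineDerivAt (EuclideanSpace.single i 1)
    exact HasDerivAt.congr_deriv this (by simp [EuclideanSpace.inner_single_right])
  have h2 := HasDerivAt.rpow_const h1 (p := q / 2) (Or.inl (by simp [hn.ne']))
  have h3 : ∀ z : EuclideanSpace ℝ (Fin N), (‖z‖ ^ 2) ^ (q / 2) = ‖z‖ ^ q := fun z => by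
    rw [← Real.rpow_natCast_mul (norm_nonneg z)]; congr 1; push_cast; ring
  have h4 : (‖x‖ ^ 2) ^ (q / 2 - 1) = ‖x‖ ^ (q - 2) := by
    rw [← Real.rpow_natCast_mul (norm_nonneg x)]; congr 1; push_cast; ring
  simp only [h3, zero_smul, add_zero, h4] at h2
  exact h2.congr_deriv (by ring)

theorem hasLineDerivAt_coord {N : ℕ} (i j : Fin N) (x : EuclideanSpace ℝ (Fin N)) :
    HasLineDerivAt ℝ (fun z : EuclideanSpace ℝ (Fin N) => z j) (if j = i then 1 else 0) x
      (EuclideanSpace.single i 1) := by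
  have h := ((EuclideanSpace.proj (𝕜 := ℝ) j).hasFDerivAt (x := x)).hasLineDerivAt
    (EuclideanSpace.single i 1)
  exact HasDerivAt.congr_deriv h (by simp)

theorem HasLineDerivAt.mul' {E : Type*} [AddCommGroup E] [Module ℝ E] {f g : E → ℝ} {f' g' : ℝ}
    {x v : E} (hf : HasLineDerivAt ℝ f f' x v) (hg : HasLineDerivAt ℝ g g' x v) :
    HasLineDerivAt ℝ (fun z => f z * g z) (f' * g x + f x * g') x v :=
  (HasDerivAt.mul hf hg).congr_deriv (by simp)

theorem HasLineDerivAt.pow' {E : Type*} [AddCommGroup E] [Module ℝ E] {f : E → ℝ} {f' : ℝ}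
    {x v : E} (hf : HasLineDerivAt ℝ f f' x v) (k : ℕ) :
    HasLineDerivAt ℝ (fun z => f z ^ k) (k * f x ^ (k - 1) * f') x v :=
  (HasDerivAt.pow hf k).congr_deriv (by simp)

theorem HasLineDerivAt.add' {E : Type*} [AddCommGroup E] [Module ℝ E] {f g : E → ℝ} {f' g' : ℝ}
    {x v : E} (hf : HasLineDerivAt ℝ f f' x v) (hg : HasLineDerivAt ℝ g g' x v) :
    HasLineDerivAt ℝ (fun z => f z + g z) (f' + g') x v :=
  HasDerivAt.add hf hg

theorem HasLineDerivAt.const_mul' {E : Type*} [AddCommGroup E] [Module ℝ E] {f : E → ℝ} {f' : ℝ}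
    {x v : E} (hf : HasLineDerivAt ℝ f f' x v) (c : ℝ) :
    HasLineDerivAt ℝ (fun z => c * f z) (c * f') x v :=
  HasDerivAt.const_mul c hf

/-- `Ψ` has two partial derivatives in each coordinate direction at the points near `x₀`, and its
Laplacian, the sum of the pure second ones, is given by `L`, which is continuous at `x₀`. -/
def HasClassicalLaplacianNear {N : ℕ} (Ψ L : EuclideanSpace ℝ (Fin N) → ℝ)
    (x₀ : EuclideanSpace ℝ (Fin N)) : Prop :=
  ∃ D₁ D₂ : Fin N → EuclideanSpace ℝ (Fin N) → ℝ,
    (∀ᶠ x in nhds x₀, ContinuousAt Ψ x ∧ L x = ∑ i, D₂ i x ∧ ∀ i,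
      HasLineDerivAt ℝ Ψ (D₁ i x) x (EuclideanSpace.single i 1) ∧
      HasLineDerivAt ℝ (D₁ i) (D₂ i x) x (EuclideanSpace.single i 1)) ∧ ContinuousAt L x₀

theorem HasClassicalLaplacianNear.add {N : ℕ} {Ψ L Ψ' L' : EuclideanSpace ℝ (Fin N) → ℝ}
    {x₀ : EuclideanSpace ℝ (Fin N)} (h : HasClassicalLaplacianNear Ψ L x₀)
    (h' : HasClassicalLaplacianNear Ψ' L' x₀) :
    HasClassicalLaplacianNear (fun x => Ψ x + Ψ' x) (fun x => L x + L' x) x₀ := by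
  obtain ⟨D₁, D₂, h, hL⟩ := h
  obtain ⟨D₁', D₂', h', hL'⟩ := h'
  refine ⟨fun i x => D₁ i x + D₁' i x, fun i x => D₂ i x + D₂' i x, ?_, hL.add hL'⟩
  filter_upwards [h, h'] with x hx hx'
  refine ⟨hx.1.add hx'.1, by rw [hx.2.1, hx'.2.1, Finset.sum_add_distrib], fun i => ⟨?_, ?_⟩⟩
  · exact (hx.2.2 i).1.add' (hx'.2.2 i).1
  · exact (hx.2.2 i).2.add' (hx'.2.2 i).2

theorem HasClassicalLaplacianNear.const_mul {N : ℕ} {Ψ L : EuclideanSpace ℝ (Fin N) → ℝ}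
    {x₀ : EuclideanSpace ℝ (Fin N)} (h : HasClassicalLaplacianNear Ψ L x₀) (c : ℝ) :
    HasClassicalLaplacianNear (fun x => c * Ψ x) (fun x => c * L x) x₀ := by
  obtain ⟨D₁, D₂, h, hL⟩ := h
  refine ⟨fun i x => c * D₁ i x, fun i x => c * D₂ i x, ?_, continuousAt_const.mul hL⟩
  filter_upwards [h] with x hx
  refine ⟨continuousAt_const.mul hx.1, by rw [hx.2.1, Finset.mul_sum], fun i => ⟨?_, ?_⟩⟩
  · exact (hx.2.2 i).1.const_mul' c
  · exact (hx.2.2 i).2.const_mul' c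

/-- `Δ(x₀ᵏ |x|^q) = k(k-1) x₀ᵏ⁻² |x|^q + (2kq + Nq + q(q-2)) x₀ᵏ |x|^(q-2)`. -/
theorem hasClassicalLaplacianNear_coord_pow_mul_norm_rpow {N : ℕ} [NeZero N] (k : ℕ) (q : ℝ)
    {x₀ : EuclideanSpace ℝ (Fin N)} (hx₀ : x₀ ≠ 0) :
    HasClassicalLaplacianNear (fun x => x 0 ^ k * ‖x‖ ^ q)
      (fun x => (k * (k - 1 : ℕ)) * x 0 ^ (k - 1 - 1) * ‖x‖ ^ q +
        (2 * k * q + N * q + q * (q - 2)) * (x 0 ^ k * ‖x‖ ^ (q - 2))) x₀ := by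
  have hcoord : ∀ x : EuclideanSpace ℝ (Fin N), ContinuousAt (fun z => z 0) x := fun x =>
    (EuclideanSpace.proj (𝕜 := ℝ) (0 : Fin N)).continuous.continuousAt
  have hrpow : ∀ x : EuclideanSpace ℝ (Fin N), x ≠ 0 → ∀ q : ℝ,
      ContinuousAt (fun z : EuclideanSpace ℝ (Fin N) => ‖z‖ ^ q) x := fun x hx q =>
    continuous_norm.continuousAt.rpow_const (Or.inl (norm_ne_zero_iff.2 hx))
  refine ⟨fun i x => (k * x 0 ^ (k - 1) * if 0 = i then 1 else 0) * ‖x‖ ^ q +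
      x 0 ^ k * (q * ‖x‖ ^ (q - 2) * x i),
    fun i x => ((k * ((k - 1 : ℕ) * x 0 ^ (k - 1 - 1) * if 0 = i then 1 else 0)) *
        if 0 = i then 1 else 0) * ‖x‖ ^ q +
      (k * x 0 ^ (k - 1) * if 0 = i then 1 else 0) * (q * ‖x‖ ^ (q - 2) * x i) +
      ((k * x 0 ^ (k - 1) * if 0 = i then 1 else 0) * (q * ‖x‖ ^ (q - 2) * x i) +
       x 0 ^ k * (q * ((q - 2) * ‖x‖ ^ (q - 2 - 2) * x i) * x i + q * ‖x‖ ^ (q - 2) * 1)),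
    ?_, ?_⟩
  · filter_upwards [isOpen_ne.mem_nhds hx₀] with x hx
    refine ⟨((hcoord x).pow k).mul (hrpow x hx q), ?_, fun i => ⟨?_, ?_⟩⟩
    · have hn : 0 < ‖x‖ := norm_pos_iff.2 hx
      have hr : ‖x‖ ^ (q - 2) = ‖x‖ ^ (q - 2 - 2) * ‖x‖ ^ 2 := by
        rw [← Real.rpow_natCast, ← Real.rpow_add hn]; congr 1; push_cast; ring
      have hsq : ∑ i, x i ^ 2 = ‖x‖ ^ 2 := by
        rw [EuclideanSpace.norm_sq_eq]; simp
      have hk : (k : ℝ) * x 0 ^ (k - 1) * x 0 = k * x 0 ^ k := by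
        rcases k with _ | k
        · simp
        · rw [Nat.add_sub_cancel, pow_succ]; ring
      have e : ∀ i, ((k * ((k - 1 : ℕ) * x 0 ^ (k - 1 - 1) * if 0 = i then 1 else 0)) *
          if 0 = i then 1 else 0) * ‖x‖ ^ q +
          (k * x 0 ^ (k - 1) * if 0 = i then 1 else 0) * (q * ‖x‖ ^ (q - 2) * x i) +
          ((k * x 0 ^ (k - 1) * if 0 = i then 1 else 0) * (q * ‖x‖ ^ (q - 2) * x i) +
          x 0 ^ k * (q * ((q - 2) * ‖x‖ ^ (q - 2 - 2) * x i) * x i + q * ‖x‖ ^ (q - 2) * 1)) =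
          (if 0 = i then (k * (k - 1 : ℕ)) * x 0 ^ (k - 1 - 1) * ‖x‖ ^ q +
            2 * (k * x 0 ^ (k - 1) * x 0) * (q * ‖x‖ ^ (q - 2)) else 0) +
          (x 0 ^ k * q * (q - 2) * ‖x‖ ^ (q - 2 - 2)) * x i ^ 2 + x 0 ^ k * q * ‖x‖ ^ (q - 2) := by
        intro i
        split_ifs with h
        · subst h; ring
        · ring
      simp_rw [e]
      rw [Finset.sum_add_distrib, Finset.sum_add_distrib, ← Finset.mul_sum, hsq,
        Finset.sum_ite_eq, if_pos (Finset.mem_univ _), Finset.sum_const, Finset.card_univ,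
        Fintype.card_fin, nsmul_eq_mul, hk, hr]
      ring
    · exact ((hasLineDerivAt_coord i 0 x).pow' k).mul' (hasLineDerivAt_norm_rpow q i hx)
    · have h1 := (((hasLineDerivAt_coord i 0 x).pow' (k - 1)).const_mul' (k : ℝ)).mul'
        (f := fun x : EuclideanSpace ℝ (Fin N) => (k : ℝ) * x 0 ^ (k - 1)) (g := fun _ => if 0 = i then (1 : ℝ) else 0)
        (g' := 0) (hasDerivAt_const (0 : ℝ) _)
      have h2 := h1.mul' (hasLineDerivAt_norm_rpow q i hx)
      have h3 := ((hasLineDerivAt_coord i 0 x).pow' k).mul'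
        (((hasLineDerivAt_norm_rpow (q - 2) i hx).const_mul' q).mul' (hasLineDerivAt_coord i i x))
      refine HasDerivAt.congr_deriv (h2.add' h3) ?_
      simp only [if_true]
      ring
  · exact ((continuousAt_const.mul ((hcoord x₀).pow _)).mul (hrpow x₀ hx₀ q)).add
      (continuousAt_const.mul (((hcoord x₀).pow k).mul (hrpow x₀ hx₀ _)))

theorem IsLocalMax.second_lineDeriv_nonpos {E : Type*} [AddCommGroup E] [Module ℝ E]
    [TopologicalSpace E] [ContinuousAdd E] [ContinuousSMul ℝ E] {f D : E → ℝ} {d : ℝ} {z v : E}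
    (h : IsLocalMax f z) (h1 : ∀ᶠ x in nhds z, HasLineDerivAt ℝ f (D x) x v)
    (h2 : HasLineDerivAt ℝ D d z v) : d ≤ 0 := by
  have hcont : Filter.Tendsto (fun t : ℝ => z + t • v) (nhds 0) (nhds z) := by
    have : Continuous fun t : ℝ => z + t • v := by fun_prop
    simpa using this.tendsto 0
  have hd : deriv (fun t : ℝ => f (z + t • v)) =ᶠ[nhds 0] fun t => D (z + t • v) := by
    filter_upwards [hcont.eventually h1] with t ht
    have h3 : HasDerivAt (fun s : ℝ => f (z + t • v + s • v)) (D (z + t • v)) (t - t) := by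
      rw [sub_self]; exact ht
    have h4 := h3.comp_sub_const t t
    refine HasDerivAt.deriv (h4.congr_of_eventuallyEq (Filter.Eventually.of_forall fun s => ?_))
    simp only
    congr 1
    module
  have hdd : deriv (deriv fun t : ℝ => f (z + t • v)) 0 = d := by
    rw [hd.deriv_eq]
    exact HasDerivAt.deriv h2
  have hmax : IsLocalMax (fun t : ℝ => f (z + t • v)) 0 := by
    have := hcont.eventually h
    simpa [IsLocalMax, IsMaxFilter] using this
  have hc : ContinuousAt (fun t : ℝ => f (z + t • v)) 0 :=
    HasDerivAt.continuousAt (h1.self_of_nhds)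
  by_contra! hpos
  have hmin := isLocalMin_of_deriv_deriv_pos (by rw [hdd]; exact hpos) hmax.deriv_eq_zero hc
  have hconst : (fun t : ℝ => f (z + t • v)) =ᶠ[nhds 0] fun _ => f (z + (0 : ℝ) • v) := by
    filter_upwards [hmax, hmin] with t ht ht'
    exact le_antisymm ht ht'
  have : deriv (deriv fun t : ℝ => f (z + t • v)) 0 = 0 := by
    rw [hconst.deriv.deriv_eq]
    simp
  linarith

theorem hasLineDerivAt_convolution_partialDeriv {N : ℕ} {w ρ : EuclideanSpace ℝ (Fin N) → ℝ}
    (hw : LocallyIntegrable w) (hρ : ContDiff ℝ ∞ ρ) (hc : HasCompactSupport ρ) (i : Fin N)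
    (z : EuclideanSpace ℝ (Fin N)) :
    HasLineDerivAt ℝ (fun z => ∫ y, w y * ρ (z - y)) (∫ y, w y * partialDeriv i ρ (z - y)) z
      (EuclideanSpace.single i 1) := by
  have h := (hc.hasFDerivAt_convolution_right (ContinuousLinearMap.lsmul ℝ ℝ) hw
    (hρ.of_le (by simp)) z).hasLineDerivAt (EuclideanSpace.single i 1)
  rw [convolution_precompR_apply _ hw (hc.fderiv ℝ) (hρ.continuous_fderiv (by simp))] at h
  exact h

theorem partialDeriv_comp_const_sub {N : ℕ} {ρ : EuclideanSpace ℝ (Fin N) → ℝ}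
    (hρ : ContDiff ℝ ∞ ρ) (i : Fin N) (z : EuclideanSpace ℝ (Fin N)) :
    partialDeriv i (fun y => ρ (z - y)) = fun y => -partialDeriv i ρ (z - y) := by
  funext y
  have h := ((hρ.differentiable (by simp)) (z - y)).hasFDerivAt.comp y
    ((hasFDerivAt_id (𝕜 := ℝ) y).const_sub z)
  have h' : HasFDerivAt (fun y => ρ (z - y)) _ y := h
  unfold partialDeriv
  rw [h'.fderiv]
  simp

theorem partialDeriv_partialDeriv_comp_const_sub {N : ℕ} {ρ : EuclideanSpace ℝ (Fin N) → ℝ}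
    (hρ : ContDiff ℝ ∞ ρ) (i : Fin N) (z : EuclideanSpace ℝ (Fin N)) :
    partialDeriv i (partialDeriv i (fun y => ρ (z - y))) =
      fun y => partialDeriv i (partialDeriv i ρ) (z - y) := by
  rw [partialDeriv_comp_const_sub hρ]
  have h := partialDeriv_comp_const_sub (hρ.partialDeriv i) i z
  funext y
  have := congrFun h y
  unfold partialDeriv at this ⊢
  rw [fderiv_fun_neg]
  simp [this]

/-- If `-Δu ≤ c` in the sense of distributions and a classical function `Ψ` touches `u` from above
at `x₀`, then `-c ≤ ΔΨ` at `x₀`. -/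
theorem HasClassicalLaplacianNear.neg_le_of_isLocalMax {N : ℕ} {U : Set (EuclideanSpace ℝ (Fin N))}
    (hU : IsOpen U) {u c Ψ L : EuclideanSpace ℝ (Fin N) → ℝ} {x₀ : EuclideanSpace ℝ (Fin N)}
    (hu : ContinuousOn u U) (hc : ContinuousOn c U)
    (H : ∀ φ : EuclideanSpace ℝ (Fin N) → ℝ, ContDiff ℝ ∞ φ → HasCompactSupport φ →
      tsupport φ ⊆ U → (∀ x, 0 ≤ φ x) →
      -∫ x in U, c x * φ x ≤ ∫ x in U, u x * ∑ i, partialDeriv i (partialDeriv i φ) x)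
    (hx₀ : x₀ ∈ U) (hΨ : HasClassicalLaplacianNear Ψ L x₀)
    (hmax : IsLocalMax (fun x => u x - Ψ x) x₀) : -c x₀ ≤ L x₀ := by
  by_contra! hlt
  obtain ⟨D₁, D₂, hD, hL⟩ := hΨ
  obtain ⟨κ, hκ1, hκ2⟩ := exists_between hlt
  obtain ⟨τ, hτ0, hτ⟩ : ∃ τ > 0, L x₀ + 2 * N * τ < κ := by
    refine ⟨(κ - L x₀) / (2 * N + 1), by apply div_pos <;> [linarith; positivity], ?_⟩
    have h1 : (0 : ℝ) < 2 * N + 1 := by positivity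
    have h2 : 2 * N * ((κ - L x₀) / (2 * N + 1)) = (κ - L x₀) * (2 * N / (2 * N + 1)) := by ring
    have h3 : (2 * N / (2 * N + 1) : ℝ) < 1 := by rw [div_lt_one h1]; linarith
    rw [h2]
    nlinarith
  have hev : ∀ᶠ x in nhds x₀, (x ∈ U ∧ L x + 2 * N * τ < κ ∧ κ < -c x ∧
      u x - Ψ x ≤ u x₀ - Ψ x₀) ∧ ContinuousAt Ψ x ∧ L x = ∑ i, D₂ i x ∧ ∀ i,
      HasLineDerivAt ℝ Ψ (D₁ i x) x (EuclideanSpace.single i 1) ∧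
      HasLineDerivAt ℝ (D₁ i) (D₂ i x) x (EuclideanSpace.single i 1) := by
    filter_upwards [hD, hU.mem_nhds hx₀, hmax,
      (hL.add continuousAt_const).eventually_lt continuousAt_const hτ,
      continuousAt_const.eventually_lt (hc.continuousAt (hU.mem_nhds hx₀)).neg hκ2]
      with x h1 h2 h3 h4 h5
    exact ⟨⟨h2, h4, h5, h3⟩, h1⟩
  obtain ⟨r₀, hr₀, hball⟩ := Metric.nhds_basis_closedBall.eventually_iff.1 hev
  obtain ⟨r, hr, hrr⟩ : ∃ r > 0, 2 * r = r₀ := ⟨r₀ / 2, by positivity, by ring⟩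
  subst hrr
  have hsubU : Metric.closedBall x₀ (2 * r) ⊆ U := fun x hx => (hball hx).1.1
  have hcomp : IsCompact (Metric.closedBall x₀ (2 * r)) := isCompact_closedBall _ _
  set w := (Metric.closedBall x₀ (2 * r)).indicator u with hw
  have hwint : Integrable w := (integrable_indicator_iff measurableSet_closedBall).2
    ((hu.mono hsubU).integrableOn_compact hcomp)
  have hunif := hcomp.uniformContinuousOn_of_continuous (hu.mono hsubU)
  rw [Metric.uniformContinuousOn_iff] at hunif
  obtain ⟨δ, hδ, hδu⟩ := hunif (τ * r ^ 2 / 3) (by positivity)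
  set ε := min δ r with hε
  have hε0 : 0 < ε := lt_min hδ hr
  let bump : ContDiffBump (0 : EuclideanSpace ℝ (Fin N)) := ⟨ε / 2, ε, by positivity, by linarith⟩
  set ρ := bump.normed volume with hρdef
  have hρ : ContDiff ℝ ∞ ρ := bump.contDiff_normed
  have hρc : HasCompactSupport ρ := bump.hasCompactSupport_normed
  set g : EuclideanSpace ℝ (Fin N) → ℝ := fun z => ∫ y, w y * ρ (z - y) with hg
  have hsmall : ∀ z ∈ Metric.closedBall x₀ r, |g z - u z| ≤ τ * r ^ 2 / 3 := by
    intro z hz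
    have hmem : ∀ x ∈ Metric.ball z ε, x ∈ Metric.closedBall x₀ (2 * r) := by
      intro x hx
      rw [Metric.mem_ball] at hx
      rw [Metric.mem_closedBall] at hz ⊢
      have := dist_triangle x z x₀
      have : ε ≤ r := min_le_right _ _
      linarith
    have hd := bump.dist_normed_convolution_le (μ := volume) (g := w) (x₀ := z)
      (ε := τ * r ^ 2 / 3) hwint.aestronglyMeasurable (by
        intro x hx
        have hx' := hmem x hx
        have hz' := hmem z (Metric.mem_ball_self hε0)
        rw [hw, indicator_of_mem hx', indicator_of_mem hz']
        exact (hδu x hx' z hz' (lt_of_lt_of_le hx (min_le_left _ _))).le)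
    rw [convolution_lsmul_swap, Real.dist_eq] at hd
    have hz' := hmem z (Metric.mem_ball_self hε0)
    have : w z = u z := by rw [hw, indicator_of_mem hz']
    rw [this] at hd
    convert hd using 4
    simp [mul_comm, hρdef]
  have hgd : ∀ i z, HasLineDerivAt ℝ g (∫ y, w y * partialDeriv i ρ (z - y)) z
      (EuclideanSpace.single i 1) := fun i z =>
    hasLineDerivAt_convolution_partialDeriv hwint.locallyIntegrable hρ hρc i z
  have hgdd : ∀ i z, HasLineDerivAt ℝ (fun z => ∫ y, w y * partialDeriv i ρ (z - y))
      (∫ y, w y * partialDeriv i (partialDeriv i ρ) (z - y)) z (EuclideanSpace.single i 1) :=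
    fun i z => hasLineDerivAt_convolution_partialDeriv hwint.locallyIntegrable
      (hρ.partialDeriv i) (hρc.partialDeriv i) i z
  have hgc : Continuous g :=
    hρc.continuous_convolution_right (ContinuousLinearMap.lsmul ℝ ℝ) hwint.locallyIntegrable
      hρ.continuous
  -- the Laplacian of the mollification is at least `κ` near `x₀`
  have hlap : ∀ z ∈ Metric.closedBall x₀ r,
      κ ≤ ∑ i, ∫ y, w y * partialDeriv i (partialDeriv i ρ) (z - y) := by
    intro z hz
    set φ : EuclideanSpace ℝ (Fin N) → ℝ := fun y => ρ (z - y) with hφ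
    have hφs : ContDiff ℝ ∞ φ := hρ.comp (contDiff_const.sub contDiff_id)
    have hφt : tsupport φ ⊆ Metric.closedBall x₀ (2 * r) := by
      refine closure_minimal ?_ Metric.isClosed_closedBall
      intro y hy
      have hy' : z - y ∈ Function.support ρ := hy
      rw [hρdef, bump.support_normed_eq, mem_ball_zero_iff] at hy'
      rw [Metric.mem_closedBall] at hz ⊢
      have h1 := dist_triangle y z x₀
      have h2 : dist y z < ε := by rw [dist_comm, dist_eq_norm]; exact hy'
      have : ε ≤ r := min_le_right _ _
      linarith
    have hφc : HasCompactSupport φ := hcomp.of_isClosed_subset (isClosed_tsupport _) hφt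
    have hφ0 : ∀ x, 0 ≤ φ x := fun x => bump.nonneg_normed _
    have hφint : Integrable φ := hφs.continuous.integrable_of_hasCompactSupport hφc
    have hφ1 : ∫ y, φ y = 1 := by
      rw [hφ, integral_sub_left_eq_self ρ]
      exact bump.integral_normed
    have hmain := H φ hφs hφc (hφt.trans hsubU) hφ0
    have hleft : κ ≤ -∫ x in U, c x * φ x := by
      have h1 : ∫ x in U, c x * φ x ≤ ∫ x in U, -κ * φ x := by
        refine integral_mono_ae ?_ (hφint.integrableOn.const_mul _) ?_
        · exact (hc.locallyIntegrableOn hU.measurableSet).integrable_mul_of_tsupport_subset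
            hφs.continuous hφc (hφt.trans hsubU)
        · refine Filter.Eventually.of_forall fun x => ?_
          by_cases hx : x ∈ Metric.closedBall x₀ (2 * r)
          · have := (hball hx).1.2.2.1
            exact mul_le_mul_of_nonneg_right (by linarith) (hφ0 x)
          · have : φ x = 0 := image_eq_zero_of_notMem_tsupport fun h => hx (hφt h)
            simp [this]
      have h2 : ∫ x in U, φ x = 1 := by
        rw [setIntegral_eq_integral_of_forall_compl_eq_zero, hφ1]
        exact fun x hx => image_eq_zero_of_notMem_tsupport fun h => hx (hsubU (hφt h))
      rw [integral_const_mul, h2] at h1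
      linarith
    refine (hleft.trans hmain).trans_eq ?_
    have hsuppD : ∀ i, tsupport (partialDeriv i (partialDeriv i φ)) ⊆
        Metric.closedBall x₀ (2 * r) := fun i =>
      (tsupport_partialDeriv_subset _ i).trans ((tsupport_partialDeriv_subset _ i).trans hφt)
    simp_rw [Finset.mul_sum]
    rw [integral_finsetSum]
    · refine Finset.sum_congr rfl fun i _ => ?_
      rw [setIntegral_eq_integral_of_forall_compl_eq_zero]
      · refine integral_congr_ae (Filter.Eventually.of_forall fun y => ?_)
        have hpd := congrFun (partialDeriv_partialDeriv_comp_const_sub hρ i z) y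
        simp only
        rw [← hpd]
        by_cases hy : y ∈ Metric.closedBall x₀ (2 * r)
        · rw [hw, indicator_of_mem hy]
        · rw [image_eq_zero_of_notMem_tsupport fun h => hy (hsuppD i h)]
          simp only [mul_zero]
      · intro x hx
        rw [image_eq_zero_of_notMem_tsupport fun h => hx (hsubU (hsuppD i h)), mul_zero]
    · intro i _
      exact (hu.locallyIntegrableOn hU.measurableSet).integrable_mul_of_tsupport_subset
        ((hφs.partialDeriv i).partialDeriv i).continuous
        ((hφc.partialDeriv i).partialDeriv i) ((hsuppD i).trans hsubU)
  -- maximize the perturbed difference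
  have hsub : Metric.closedBall x₀ r ⊆ Metric.closedBall x₀ (2 * r) :=
    Metric.closedBall_subset_closedBall (by linarith)
  set G : EuclideanSpace ℝ (Fin N) → ℝ := fun x => g x - Ψ x - τ * ‖x - x₀‖ ^ 2 with hGdef
  have hGc : ContinuousOn G (Metric.closedBall x₀ r) := by
    refine (hgc.continuousOn.sub fun x hx => (hball (hsub hx)).2.1.continuousWithinAt).sub ?_
    fun_prop
  obtain ⟨z, hz, hzmax⟩ := (isCompact_closedBall x₀ r).exists_isMaxOn
    ⟨x₀, Metric.mem_closedBall_self hr.le⟩ hGc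
  have hzlt : z ∈ Metric.ball x₀ r := by
    rw [Metric.mem_ball]
    refine lt_of_le_of_ne hz fun heq => ?_
    have h1 : G x₀ ≤ G z := hzmax (Metric.mem_closedBall_self hr.le)
    have h2 := (hball (hsub hz)).1.2.2.2
    have h3 := abs_le.1 (hsmall z hz)
    have h4 := abs_le.1 (hsmall x₀ (Metric.mem_closedBall_self hr.le))
    rw [dist_eq_norm] at heq
    simp only [hGdef, heq, sub_self, norm_zero] at h1
    have : 0 < τ * r ^ 2 := by positivity
    linarith [h3.1, h3.2, h4.1, h4.2]
  have hzloc : IsLocalMax G z := by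
    filter_upwards [Metric.isOpen_ball.mem_nhds hzlt] with x hx
    exact hzmax (Metric.ball_subset_closedBall hx)
  have hquad : ∀ i x, HasLineDerivAt ℝ (fun x : EuclideanSpace ℝ (Fin N) => ‖x - x₀‖ ^ 2)
      (2 * (x i - x₀ i)) x (EuclideanSpace.single i 1) := by
    intro i x
    have h1 := (((hasFDerivAt_id (𝕜 := ℝ) x).sub_const x₀).norm_sq).hasLineDerivAt
      (EuclideanSpace.single i 1)
    exact HasDerivAt.congr_deriv h1 (by simp [EuclideanSpace.inner_single_right])
  have hstep : ∀ i, (∫ y, w y * partialDeriv i (partialDeriv i ρ) (z - y)) ≤ D₂ i z + 2 * τ := by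
    intro i
    have h1 : ∀ᶠ x in nhds z, HasLineDerivAt ℝ G
        ((∫ y, w y * partialDeriv i ρ (x - y)) - D₁ i x - τ * (2 * (x i - x₀ i))) x
        (EuclideanSpace.single i 1) := by
      filter_upwards [Metric.isOpen_ball.mem_nhds hzlt] with x hx
      have hx' := (hball (hsub (Metric.ball_subset_closedBall hx))).2.2.2 i
      exact ((HasDerivAt.sub (hgd i x) hx'.1)).sub ((hquad i x).const_mul' τ)
    have hz' := (hball (hsub hz)).2.2.2 i
    have h2 : HasLineDerivAt ℝ (fun x => (∫ y, w y * partialDeriv i ρ (x - y)) - D₁ i x -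
        τ * (2 * (x i - x₀ i)))
        ((∫ y, w y * partialDeriv i (partialDeriv i ρ) (z - y)) - D₂ i z - τ * (2 * 1)) z
        (EuclideanSpace.single i 1) := by
      have h3 : HasLineDerivAt ℝ (fun x : EuclideanSpace ℝ (Fin N) => x i - x₀ i) 1 z
          (EuclideanSpace.single i 1) :=
        HasDerivAt.congr_deriv (HasDerivAt.sub_const (x₀ i) (hasLineDerivAt_coord i i z)) (by simp)
      exact (HasDerivAt.sub (hgdd i z) hz'.2).sub ((h3.const_mul' 2).const_mul' τ)
    have := hzloc.second_lineDeriv_nonpos h1 h2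
    linarith
  have h1 := hlap z hz
  have h2 : ∑ i, (∫ y, w y * partialDeriv i (partialDeriv i ρ) (z - y)) ≤
      ∑ i, (D₂ i z + 2 * τ) := Finset.sum_le_sum fun i _ => hstep i
  have h3 := (hball (hsub hz)).2.2.1
  have h4 := (hball (hsub hz)).1.2.1
  rw [Finset.sum_add_distrib, ← h3] at h2
  simp only [Finset.sum_const, Finset.card_univ, Fintype.card_fin, nsmul_eq_mul] at h2
  linarith

/-- The barrier `|x|^p (2 M x₀ + ε (|x|² - M x₀ |x| - B x₀²))` on the half-space. -/
noncomputable def hardyBarrier {N : ℕ} [NeZero N] (p M B ε : ℝ) (x : EuclideanSpace ℝ (Fin N)) : ℝ :=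
  2 * M * (x 0 ^ 1 * ‖x‖ ^ p) + ε * (x 0 ^ 0 * ‖x‖ ^ (p + 2) +
    (-M * (x 0 ^ 1 * ‖x‖ ^ (p + 1)) + -B * (x 0 ^ 2 * ‖x‖ ^ p)))

theorem EuclideanSpace.apply_le_norm {N : ℕ} (i : Fin N) (x : EuclideanSpace ℝ (Fin N)) :
    x i ≤ ‖x‖ :=
  (le_abs_self _).trans (PiLp.norm_apply_le x i)

theorem norm_pos_of_apply_pos {N : ℕ} {i : Fin N} {x : EuclideanSpace ℝ (Fin N)} (hx : 0 < x i) :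
    0 < ‖x‖ :=
  hx.trans_le (EuclideanSpace.apply_le_norm i x)

theorem hardyBarrier_eq {N : ℕ} [NeZero N] (p M B ε : ℝ) {x : EuclideanSpace ℝ (Fin N)}
    (hx : 0 < ‖x‖) : hardyBarrier p M B ε x =
      ‖x‖ ^ p * (2 * M * x 0 + ε * (‖x‖ ^ 2 - M * x 0 * ‖x‖ - B * x 0 ^ 2)) := by
  unfold hardyBarrier
  rw [Real.rpow_add hx, Real.rpow_add hx, Real.rpow_one, Real.rpow_two]
  ring

theorem le_hardyBarrier {N : ℕ} [NeZero N] {p M B ε : ℝ} (hB : 0 ≤ B) (hBM : B ≤ M) (hε : 0 ≤ ε)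
    {x : EuclideanSpace ℝ (Fin N)} (hx : 0 < x 0) (hεx : ε * ‖x‖ ≤ 1) :
    ε * ‖x‖ ^ (p + 2) ≤ hardyBarrier p M B ε x := by
  have hn : 0 < ‖x‖ := norm_pos_of_apply_pos hx
  have hle := EuclideanSpace.apply_le_norm 0 x
  rw [hardyBarrier_eq _ _ _ _ hn, Real.rpow_add hn, Real.rpow_two]
  have h1 : M * x 0 * (ε * ‖x‖) ≤ M * x 0 * 1 :=
    mul_le_mul_of_nonneg_left hεx (mul_nonneg (hB.trans hBM) hx.le)
  have h2 : B * x 0 * (ε * x 0) ≤ M * x 0 * 1 :=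
    mul_le_mul (mul_le_mul_of_nonneg_right hBM hx.le)
      ((mul_le_mul_of_nonneg_left hle hε).trans hεx) (mul_nonneg hε hx.le)
      (mul_nonneg (hB.trans hBM) hx.le)
  have h3 : ε * ‖x‖ ^ 2 ≤ 2 * M * x 0 + ε * (‖x‖ ^ 2 - M * x 0 * ‖x‖ - B * x 0 ^ 2) := by
    linarith
  have := mul_le_mul_of_nonneg_left h3 (Real.rpow_pos_of_pos hn p).le
  linarith

/-- For suitable constants the barrier is a strict supersolution of `-Δψ = K ψ / |x|²`. -/
theorem exists_hardyBarrier_supersolution (N : ℕ) [NeZero N] {a K : ℝ} (ha0 : 0 ≤ a)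
    (hKa : K ≤ (N : ℝ) ^ 2 / 4 - a ^ 2) :
    ∃ M B : ℝ, 0 ≤ B ∧ B ≤ M ∧ ∀ ε > 0, ∀ x : EuclideanSpace ℝ (Fin N), 0 < x 0 → ε * ‖x‖ ≤ 1 →
      ∃ L, HasClassicalLaplacianNear (hardyBarrier (a - N / 2) M B ε) L x ∧
        L x < -(K * (hardyBarrier (a - N / 2) M B ε x / ‖x‖ ^ 2)) := by
  set D : ℝ := (N : ℝ) ^ 2 / 4 - a ^ 2 - K with hD
  have hD0 : 0 ≤ D := by linarith
  set Λ : ℝ := |2 * a + N - D| with hΛ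
  have hΛ0 : 0 ≤ Λ := abs_nonneg _
  have hΛ1 : 2 * a + N - D ≤ Λ := le_abs_self _
  have hΛ2 : -Λ ≤ 2 * a + N - D := neg_abs_le _
  have hN1 : (1 : ℝ) ≤ N := by exact_mod_cast NeZero.one_le
  have hBM : Λ + 1 ≤ (Λ + 1) * (Λ + 2 * N) := by nlinarith
  refine ⟨(Λ + 1) * (Λ + 2 * N), Λ + 1, by positivity, hBM, ?_⟩
  set M : ℝ := (Λ + 1) * (Λ + 2 * N) with hM
  have hM0 : 0 ≤ M := by positivity
  intro ε hε x hx hεx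
  have hn : 0 < ‖x‖ := norm_pos_of_apply_pos hx
  have hle := EuclideanSpace.apply_le_norm 0 x
  have hx0 : x ≠ 0 := norm_pos_iff.1 hn
  have hl := fun k q => hasClassicalLaplacianNear_coord_pow_mul_norm_rpow k q hx0
  refine ⟨_, ((hl 1 (a - N / 2)).const_mul (2 * M)).add (((hl 0 (a - N / 2 + 2)).add
    (((hl 1 (a - N / 2 + 1)).const_mul (-M)).add
      ((hl 2 (a - N / 2)).const_mul (-(Λ + 1))))).const_mul ε), ?_⟩
  rw [hardyBarrier_eq _ _ _ _ hn]
  set p : ℝ := a - N / 2 with hp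
  set s : ℝ := ‖x‖ ^ (p - 2) with hs
  have hs0 : 0 < s := Real.rpow_pos_of_pos hn _
  have e0 : ‖x‖ ^ p = s * ‖x‖ ^ 2 := by
    rw [hs, ← Real.rpow_two, ← Real.rpow_add hn]; congr 1; ring
  have e1 : ‖x‖ ^ (p + 1 - 2) = s * ‖x‖ := by
    rw [hs, ← Real.rpow_add_one hn.ne']; congr 1; ring
  have e2 : ‖x‖ ^ (p + 2 - 2) = s * ‖x‖ ^ 2 := by rw [← e0]; congr 1; ring
  simp only [e0, e1, e2]
  have hdiv : s * ‖x‖ ^ 2 * (2 * M * x 0 + ε * (‖x‖ ^ 2 - M * x 0 * ‖x‖ - (Λ + 1) * x 0 ^ 2)) /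
      ‖x‖ ^ 2 = s * (2 * M * x 0 + ε * (‖x‖ ^ 2 - M * x 0 * ‖x‖ - (Λ + 1) * x 0 ^ 2)) := by
    field_simp
  rw [hdiv]
  set y := x 0
  set r := ‖x‖
  have hbr : -(2 * M * y * D) + ε * (r ^ 2 * (2 * a + N - D) + M * y * r * (D - 2 * a - 1) -
      2 * (Λ + 1) * r ^ 2 - (Λ + 1) * y ^ 2 * (2 * a - N - D)) < 0 := by
    have hMy : 0 ≤ M * y := mul_nonneg hM0 hx.le
    have h1 : M * y * D * (ε * r) ≤ M * y * D * 1 :=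
      mul_le_mul_of_nonneg_left hεx (mul_nonneg hMy hD0)
    have h2 : (Λ + 1) * y ^ 2 * (-(2 * a - N - D)) ≤ M * y * r := by
      have h3 : (Λ + 1) * y ^ 2 * (-(2 * a - N - D)) ≤ (Λ + 1) * y ^ 2 * (Λ + 2 * N) :=
        mul_le_mul_of_nonneg_left (by linarith) (by positivity)
      have h4 := mul_le_mul_of_nonneg_left hle hMy
      have h5 : (Λ + 1) * y ^ 2 * (Λ + 2 * N) = M * y * y := by rw [hM]; ring
      linarith
    have h3 : r ^ 2 * (2 * a + N - D) ≤ r ^ 2 * Λ :=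
      mul_le_mul_of_nonneg_left hΛ1 (by positivity)
    have h4 : 0 ≤ M * y * r * (2 * a) := by positivity
    have h5 : 0 < r ^ 2 * (Λ + 2) := by positivity
    have h6 : r ^ 2 * (2 * a + N - D) + M * y * r * (- 2 * a - 1) -
      2 * (Λ + 1) * r ^ 2 - (Λ + 1) * y ^ 2 * (2 * a - N - D) < 0 := by linarith
    have h7 := mul_neg_of_pos_of_neg hε h6
    have h8 : 0 ≤ M * y * D := mul_nonneg hMy hD0
    linarith
  have hfin := mul_neg_of_pos_of_neg hs0 hbr
  rw [lt_neg_iff_add_neg]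
  refine lt_of_eq_of_lt ?_ hfin
  have hKD : K = (N : ℝ) ^ 2 / 4 - a ^ 2 - D := by rw [hD]; ring
  rw [hKD, hp]
  push_cast
  ring

theorem theorem4p2 (N : ℕ) [NeZero N] (Ω : Set (EuclideanSpace ℝ (Fin N))) (hΩ : IsOpen Ω)
    (hhalf : closure Ω ⊆ {x : EuclideanSpace ℝ (Fin N) | 0 < x 0})
    (a b C K : ℝ) (ha0 : 0 ≤ a) (ha : a < (N : ℝ) / 2) (hb : 0 ≤ b) (hC : 0 < C) (hK : 0 < K)
    (hKa : K ≤ (N : ℝ) ^ 2 / 4 - a ^ 2) (hN : (N : ℝ) < 2 * a + 2 * b + 2)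
    (u : EuclideanSpace ℝ (Fin N) → ℝ)
    (hu : MemSobolevLoc (N : ℝ≥0∞) Ω 2 u) (huc : ContinuousOn u (closure Ω))
    (hbound : ∀ x ∈ Ω, u x ≤ C * ‖x‖ ^ (-b))
    (Lu : EuclideanSpace ℝ (Fin N) → ℝ) (hLu : HasWeakLaplacian Ω u Lu)
    (hineq : ∀ᵐ x ∂volume.restrict Ω, -Lu x ≤ K * (u x / ‖x‖ ^ 2))
    (hbdry : ∀ x ∈ frontier Ω, u x ≤ 0) :
    ∀ x ∈ Ω, u x ≤ 0 := by
  obtain ⟨M, B, hB, hBM, hbar⟩ := exists_hardyBarrier_supersolution N ha0 hKa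
  set p : ℝ := a - N / 2 with hp
  have hpos : ∀ x ∈ closure Ω, 0 < ‖x‖ := fun x hx => norm_pos_of_apply_pos (hhalf hx)
  have huΩ : ContinuousOn u Ω := huc.mono subset_closure
  have hc : ContinuousOn (fun x => K * (u x / ‖x‖ ^ 2)) Ω :=
    continuousOn_const.mul (huΩ.div (by fun_prop)
      fun x hx => (pow_pos (hpos x (subset_closure hx)) 2).ne')
  have hcompare : ∀ R : ℝ, 0 < R → ∀ x ∈ Ω, ‖x‖ ≤ R →
      u x ≤ C * R ^ (-b - (p + 1)) * hardyBarrier p M B R⁻¹ x := by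
    intro R hR x hx hxR
    set ψ : EuclideanSpace ℝ (Fin N) → ℝ := hardyBarrier p M B R⁻¹ with hψ
    set l := C * R ^ (-b - (p + 1)) with hl
    have hl0 : 0 < l := mul_pos hC (Real.rpow_pos_of_pos hR _)
    have hR' : 0 < R⁻¹ := inv_pos.2 hR
    have hεle : ∀ {x : EuclideanSpace ℝ (Fin N)}, ‖x‖ ≤ R → R⁻¹ * ‖x‖ ≤ 1 := fun {x} h => by
      rw [inv_mul_le_one₀ hR]; exact h
    have hψge : ∀ z ∈ closure Ω, ‖z‖ ≤ R → R⁻¹ * ‖z‖ ^ (p + 2) ≤ ψ z := fun z hz hzR =>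
      le_hardyBarrier hB hBM hR'.le (hhalf hz) (hεle hzR)
    have hψ0 : ∀ z ∈ closure Ω, ‖z‖ ≤ R → 0 < ψ z := fun z hz hzR =>
      (mul_pos hR' (Real.rpow_pos_of_pos (hpos z hz) _)).trans_le (hψge z hz hzR)
    by_contra! hlt
    set S := closure Ω ∩ Metric.closedBall 0 R with hS
    have hScomp : IsCompact S := (isCompact_closedBall 0 R).inter_left isClosed_closure
    have hxS : x ∈ S := ⟨subset_closure hx, mem_closedBall_zero_iff.2 hxR⟩
    have hquot : ContinuousOn (fun z => u z / ψ z) S := by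
      refine (huc.mono inter_subset_left).div (fun z hz => ?_)
        fun z hz => (hψ0 z hz.1 (mem_closedBall_zero_iff.1 hz.2)).ne'
      obtain ⟨L, hL, -⟩ := hbar R⁻¹ hR' z (hhalf hz.1) (hεle (mem_closedBall_zero_iff.1 hz.2))
      obtain ⟨D₁, D₂, hD, -⟩ := hL
      exact hD.self_of_nhds.1.continuousWithinAt
    obtain ⟨z, hzS, hzmax⟩ := hScomp.exists_isMaxOn ⟨x, hxS⟩ hquot
    have hzR : ‖z‖ ≤ R := mem_closedBall_zero_iff.1 hzS.2
    have hψz := hψ0 z hzS.1 hzR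
    set m := u z / ψ z with hm
    have huz : u z = m * ψ z := by rw [hm, div_mul_cancel₀ _ hψz.ne']
    have hml : l < m := by
      have h1 : u x / ψ x ≤ m := hzmax hxS
      have h2 : l < u x / ψ x := by
        rw [lt_div_iff₀ (hψ0 x hxS.1 hxR)]; exact hlt
      linarith
    have hm0 : 0 < m := hl0.trans hml
    have hzΩ : z ∈ Ω := by
      by_contra hz
      have h1 : z ∈ frontier Ω := by rw [hΩ.frontier_eq]; exact ⟨hzS.1, hz⟩
      have h2 := hbdry z h1
      have h3 := mul_pos hm0 hψz
      linarith
    have hzlt : ‖z‖ < R := by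
      refine lt_of_le_of_ne hzR fun heq => ?_
      have h1 := hbound z hzΩ
      have h2 := hψge z hzS.1 hzR
      rw [heq] at h1 h2
      have h3 : R⁻¹ * R ^ (p + 2) = R ^ (p + 1) := by
        rw [← Real.rpow_neg_one, ← Real.rpow_add hR]; congr 1; ring
      have h4 : C * R ^ (-b) = l * R ^ (p + 1) := by
        rw [hl, mul_assoc, ← Real.rpow_add hR]; congr 2; ring
      rw [h3] at h2
      have h5 := mul_le_mul_of_nonneg_left h2 hl0.le
      have h6 := mul_lt_mul_of_pos_right hml hψz
      linarith
    have hlocmax : IsLocalMax (fun y => u y - m * ψ y) z := by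
      filter_upwards [hΩ.mem_nhds hzΩ, Metric.isOpen_ball.mem_nhds
        (mem_ball_zero_iff.2 hzlt)] with y hyΩ hyR
      have hyR' : ‖y‖ ≤ R := (mem_ball_zero_iff.1 hyR).le
      have hyc : y ∈ closure Ω := subset_closure hyΩ
      have h1 : u y / ψ y ≤ m := hzmax ⟨hyc, mem_closedBall_zero_iff.2 hyR'⟩
      rw [div_le_iff₀ (hψ0 y hyc hyR')] at h1
      linarith
    obtain ⟨L, hL, hLlt⟩ := hbar R⁻¹ hR' z (hhalf hzS.1) (hεle hzR)
    have htouch := (hL.const_mul m).neg_le_of_isLocalMax hΩ huΩ hc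
      (fun φ h1 h2 h3 h4 => hLu.neg_integral_le hΩ hc hineq h1 h2 h3 h4) hzΩ hlocmax
    have h1 := mul_lt_mul_of_pos_left hLlt hm0
    have h2 : K * (u z / ‖z‖ ^ 2) = m * (K * (ψ z / ‖z‖ ^ 2)) := by rw [huz]; ring
    rw [h2] at htouch
    linarith
  intro x hx
  have hn := hpos x (subset_closure hx)
  have hx0 : 0 < x 0 := hhalf (subset_closure hx)
  set A : ℝ := ‖x‖ ^ p * (2 * M * x 0 + ‖x‖ ^ 2) with hA
  have hexp : 0 < b + p + 1 := by rw [hp]; linarith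
  have hlim : Filter.Tendsto (fun R : ℝ => C * R ^ (-(b + p + 1)) * A) Filter.atTop (nhds 0) := by
    simpa using ((tendsto_rpow_neg_atTop hexp).const_mul C).mul_const A
  refine ge_of_tendsto hlim ?_
  filter_upwards [Filter.eventually_ge_atTop 1, Filter.eventually_ge_atTop ‖x‖] with R hR1 hRx
  have hR : 0 < R := by linarith
  refine (hcompare R hR x hx hRx).trans ?_
  rw [show -b - (p + 1) = -(b + p + 1) by ring]
  refine mul_le_mul_of_nonneg_left ?_ (mul_pos hC (Real.rpow_pos_of_pos hR _)).le
  rw [hardyBarrier_eq _ _ _ _ hn, hA]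
  refine mul_le_mul_of_nonneg_left ?_ (Real.rpow_pos_of_pos hn p).le
  have hR1' : R⁻¹ ≤ 1 := inv_le_one_of_one_le₀ hR1
  have hR0 : 0 < R⁻¹ := inv_pos.2 hR
  have h1 : 0 ≤ R⁻¹ * (M * x 0 * ‖x‖ + B * x 0 ^ 2) := by
    have := hB.trans hBM
    positivity
  have h2 : R⁻¹ * ‖x‖ ^ 2 ≤ 1 * ‖x‖ ^ 2 := mul_le_mul_of_nonneg_right hR1' (by positivity)
  linarith
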